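/- Let $K$ be a field (of any characteristic), and let $(V,\omega)$ be a symplectic vector space over $K$ of dimension $2n$, i.e. $\omega$ is a non-degenerate alternating bilinear form on $V$. A basis $(e_1,\dots,e_n,f_1,\dots,f_n)$ of $V$ is called symplectic if $\omega(e_i,e_j)=\omega(f_i,f_j)=0$ and $\omega(e_i,f_j)=\delta_{ij}$ for all $i,j$. For $M\in\operatorname{End}(V)$ let $M^{*\omega}$ be its symplectic adjoint, determined by $\omega(Mv,w)=\omega(v,M^{*\omega}w)$ for all $v,w\in V$, and let \[ P^{\omega}_M(s,t)=\operatorname{Pf}\Bigl(\omega\bigl(v_i,\,[(M-sE)(M^{*\omega}-sE)-tE]\,v_j\bigr)\Bigr)_{1\le i,j\le 2n}\in K[s,t] \] be its symplectic characteristic polynomial, where $E$ is the identity, $\omega$ and $M$ are extended linearly to scalars in $K[s,t]$, and $(v_1,\dots,v_{2n})=(e_1,f_1,\dots,e_n,f_n)$ for a symplectic basis $(e_1,\dots,e_n,f_1,\dots,f_n)$ of $V$ (the Pfaffian does not depend on the choice of this basis). An endomorphism is called symplectically diagonalizable if $V$ has a symplectic basis consisting of eigenvectors of it. Theorem. Let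 $M\in\operatorname{End}(V)$ satisfy $MM^{*\omega}=M^{*\omega}M$, and suppose that \[ P^{\omega}_M(s,t)=\prod_{i=1}^n\{(\lambda_i-s)(\mu_i-s)-t\},\qquad \lambda_i,\mu_i\in K, \] where $(\lambda_i-s)(\mu_i-s)\neq(\lambda_j-s)(\mu_j-s)$ as polynomials in $s$ for $i\neq j$, and $\lambda_i\neq\mu_i$ for all $i$. Then there is a symplectic basis $(e_1,\dots,e_n,f_1,\dots,f_n)$ of $V$ such that, for all $i\in\{1,\dots,n\}$, \[ Me_i=\lambda_ie_i,\quad M^{*\omega}e_i=\mu_ie_i,\quad Mf_i=\mu_if_i,\quad M^{*\omega}f_i=\lambda_if_i . \] In particular, $M$ is symplectically diagonalizable. -/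

import Mathlib

open Polynomial
open scoped TensorProduct

namespace SymplecticLA

/-- The Pfaffian of a square matrix of even size `2n` over a commutative ring, by Laplace
expansion along the first row: with indices `0, …, 2n+1`,
`Pf A = ∑_{j = 1}^{2n+1} (-1)^(j-1) A_{0,j} Pf (A with rows and columns 0, j deleted)`,
and the Pfaffian of the empty matrix is `1`.  (Meaningful for alternating matrices.) -/
def pfaffian {R : Type*} [CommRing R] :
    (n : ℕ) → Matrix (Fin (2 * n)) (Fin (2 * n)) R → R
  | 0, _ => 1
  | n + 1, A =>
    let A' : Matrix (Fin (2 * n + 1 + 1)) (Fin (2 * n + 1 + 1)) R :=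
      A.submatrix (Fin.cast (by omega)) (Fin.cast (by omega))
    ∑ j : Fin (2 * n + 1), (-1) ^ (j : ℕ) * A' 0 j.succ *
      pfaffian n (A'.submatrix (fun k => (j.succAbove k).succ) (fun k => (j.succAbove k).succ))

section

variable {K V : Type*} [Field K] [AddCommGroup V] [Module K V]

/-- A symplectic form: an alternating non-degenerate bilinear form. -/
structure IsSymplectic (ω : LinearMap.BilinForm K V) : Prop where
  alt : ω.IsAlt
  nondegenerate : ω.Nondegenerate

/-- The relations of a symplectic family: `ω(e_i,e_j) = 0`, `ω(f_i,f_j) = 0`,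
`ω(e_i,f_j) = δ_ij`. -/
def SymplecticRelations (ω : LinearMap.BilinForm K V) {ι : Type*} [DecidableEq ι]
    (e f : ι → V) : Prop :=
  ∀ i j, ω (e i) (e j) = 0 ∧ ω (f i) (f j) = 0 ∧ ω (e i) (f j) = if i = j then 1 else 0

/-- A basis `(e_1, …, e_n, f_1, …, f_n)`, where `e_i = B (inl i)` and `f_i = B (inr i)`, is
symplectic if it satisfies the symplectic relations. -/
def IsSymplecticBasis (ω : LinearMap.BilinForm K V) {n : ℕ}
    (B : Module.Basis (Fin n ⊕ Fin n) K V) : Prop :=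
  SymplecticRelations ω (fun i => B (Sum.inl i)) (fun i => B (Sum.inr i))

/-- `M` is symplectically diagonalizable if there is a symplectic basis consisting of
eigenvectors of `M`. -/
def IsSymplecticallyDiagonalizable (ω : LinearMap.BilinForm K V) (M : Module.End K V) : Prop :=
  ∃ (n : ℕ) (B : Module.Basis (Fin n ⊕ Fin n) K V), IsSymplecticBasis ω B ∧
    ∀ k, ∃ c : K, Module.End.HasEigenvector M c (B k)

/-! ### Existence of symplectic bases -/

theorem SymplecticRelations.linearIndependent {ω : LinearMap.BilinForm K V} (hω : ω.IsAlt)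
    {n : ℕ} {e f : Fin n → V} (h : SymplecticRelations ω e f) :
    LinearIndependent K (Sum.elim e f) := by
  rw [Fintype.linearIndependent_iff]
  intro g hg
  have hfe : ∀ i j, ω (f i) (e j) = if j = i then (-1 : K) else 0 := by
    intro i j
    rw [← hω.neg_eq, (h j i).2.2]
    split_ifs <;> simp
  simp only [Fintype.sum_sum_type, Sum.elim_inl, Sum.elim_inr] at hg
  rintro (i | i)
  · have := congrArg (ω (f i)) hg
    simpa [hfe, (h _ _).2.1] using this
  · have := congrArg (ω (e i)) hg
    simpa [(h _ _).2.2, (h _ _).1] using this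

theorem IsSymplectic.exists_relations [FiniteDimensional K V] {ω : LinearMap.BilinForm K V}
    (hω : IsSymplectic ω) {n : ℕ} (hn : Module.finrank K V = 2 * n) (k : ℕ) (hk : k ≤ n) :
    ∃ e f : Fin k → V, SymplecticRelations ω e f := by
  induction k with
  | zero => exact ⟨Fin.elim0, Fin.elim0, fun i => i.elim0⟩
  | succ k ih =>
    obtain ⟨e, f, h⟩ := ih (by omega)
    have hfe : ∀ i j, ω (f i) (e j) = if j = i then (-1 : K) else 0 := by
      intro i j
      rw [← hω.alt.neg_eq, (h j i).2.2]
      split_ifs <;> simp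
    let L : V →ₗ[K] (Fin k ⊕ Fin k → K) := LinearMap.pi fun a => ω (Sum.elim e f a)
    have hL : LinearMap.ker L ≠ ⊥ := by
      apply LinearMap.ker_ne_bot_of_finrank_lt
      simp
      omega
    obtain ⟨x, hx, hx0⟩ := Submodule.exists_mem_ne_zero_of_ne_bot hL
    have hex : ∀ i, ω (e i) x = 0 := fun i => congrFun (LinearMap.mem_ker.1 hx) (Sum.inl i)
    have hfx : ∀ i, ω (f i) x = 0 := fun i => congrFun (LinearMap.mem_ker.1 hx) (Sum.inr i)
    have hxe : ∀ i, ω x (e i) = 0 := fun i => by rw [← hω.alt.neg_eq, hex, neg_zero]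
    have hxf : ∀ i, ω x (f i) = 0 := fun i => by rw [← hω.alt.neg_eq, hfx, neg_zero]
    obtain ⟨y, hy⟩ : ∃ y, ω x y ≠ 0 := by
      by_contra! hc
      exact hx0 (hω.nondegenerate.1 x hc)
    let z : V := (ω x y)⁻¹ • y
    have hz : ω x z = 1 := by simp [z, hy]
    let w : V := z - ∑ i, ω (e i) z • f i + ∑ i, ω (f i) z • e i
    have hxw : ω x w = 1 := by simp [w, hxe, hxf, hz]
    have hew : ∀ i, ω (e i) w = 0 := by
      intro i
      simp [w, (h _ _).1, (h _ _).2.2]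
    have hfw : ∀ i, ω (f i) w = 0 := by
      intro i
      simp [w, (h _ _).2.1, hfe]
    have hwf : ∀ i, ω w (f i) = 0 := fun i => by rw [← hω.alt.neg_eq, hfw, neg_zero]
    refine ⟨Fin.snoc e x, Fin.snoc f w, fun i j => ?_⟩
    refine Fin.lastCases ?_ (fun i => ?_) i <;> refine Fin.lastCases ?_ (fun j => ?_) j
    · simp [hxw, hω.alt x, hω.alt w]
    · simpa [hxe, hwf, hxf] using (Fin.castSucc_lt_last j).ne'
    · simpa [hex, hfw, hew] using (Fin.castSucc_lt_last i).ne
    · simp [h i j]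

theorem IsSymplectic.exists_basis [FiniteDimensional K V] {ω : LinearMap.BilinForm K V}
    (hω : IsSymplectic ω) {n : ℕ} (hn : Module.finrank K V = 2 * n) :
    ∃ B : Module.Basis (Fin n ⊕ Fin n) K V, IsSymplecticBasis ω B := by
  obtain ⟨e, f, h⟩ := hω.exists_relations hn n le_rfl
  refine ⟨basisOfLinearIndependentOfCardEqFinrank' _ (h.linearIndependent hω.alt)
    (by simp [hn, two_mul]), ?_⟩
  simpa [IsSymplecticBasis] using h

/-! ### Symplectic adjoint and symplectic characteristic polynomial -/

/-- The isomorphism `ω^♭ : V → V^*`, `v ↦ ω(·, v)`. -/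
noncomputable def flat [FiniteDimensional K V] (ω : LinearMap.BilinForm K V)
    (hω : IsSymplectic ω) : V ≃ₗ[K] Module.Dual K V :=
  LinearMap.BilinForm.toDual (LinearMap.BilinForm.flip ω) hω.nondegenerate.flip

theorem flat_apply [FiniteDimensional K V] (ω : LinearMap.BilinForm K V)
    (hω : IsSymplectic ω) (v u : V) : flat ω hω v u = ω u v := rfl

/-- The symplectic adjoint `M^{*ω} = (ω^♭)⁻¹ ∘ M^* ∘ ω^♭`, where `M^*` is the dual map. -/
noncomputable def symplAdjoint [FiniteDimensional K V] (ω : LinearMap.BilinForm K V)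
    (hω : IsSymplectic ω) (M : Module.End K V) : Module.End K V :=
  (flat ω hω).symm.toLinearMap ∘ₗ M.dualMap ∘ₗ (flat ω hω).toLinearMap

theorem symplAdjoint_spec [FiniteDimensional K V] (ω : LinearMap.BilinForm K V)
    (hω : IsSymplectic ω) (M : Module.End K V) (v w : V) :
    ω (M v) w = ω v (symplAdjoint ω hω M w) := by
  rw [← flat_apply ω hω (symplAdjoint ω hω M w) v]
  simp [symplAdjoint, flat_apply]

/-- A symplectic basis of a `2n`-dimensional symplectic space (a choice of one). -/
noncomputable def symplBasis [FiniteDimensional K V] (ω : LinearMap.BilinForm K V)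
    (hω : IsSymplectic ω) {n : ℕ} (hn : Module.finrank K V = 2 * n) :
    Module.Basis (Fin n ⊕ Fin n) K V :=
  (hω.exists_basis hn).choose

theorem symplBasis_spec [FiniteDimensional K V] (ω : LinearMap.BilinForm K V)
    (hω : IsSymplectic ω) {n : ℕ} (hn : Module.finrank K V = 2 * n) :
    IsSymplecticBasis ω (symplBasis ω hω hn) :=
  (hω.exists_basis hn).choose_spec

/-- The reordering `(v_0, v_1, …, v_{2n-1}) = (e_0, f_0, …, e_{n-1}, f_{n-1})` of a basis
`(e_0, …, e_{n-1}, f_0, …, f_{n-1})`. -/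
noncomputable def interleave {n : ℕ} (B : Module.Basis (Fin n ⊕ Fin n) K V) (k : Fin (2 * n)) : V :=
  if (k : ℕ) % 2 = 0 then B (Sum.inl ⟨k / 2, by omega⟩) else B (Sum.inr ⟨k / 2, by omega⟩)

/-- `Pf_ω(ω_A)` for an endomorphism `A` of the scalar extension `R ⊗ V`: the Pfaffian of the
matrix `(ω_A(v_i, v_j))`, where `ω_A(v, w) = ω(v, A w)` and
`(v_i) = (e_1, f_1, …, e_n, f_n)` comes from the symplectic basis `B` of `V`.  It does not
depend on the symplectic basis, because symplectic automorphisms have determinant `1`. -/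
noncomputable def pfaffianForm (R : Type*) [CommRing R] [Algebra K R]
    (ω : LinearMap.BilinForm K V) {n : ℕ} (B : Module.Basis (Fin n ⊕ Fin n) K V)
    (A : Module.End R (R ⊗[K] V)) : R :=
  pfaffian n (Matrix.of fun i j =>
    LinearMap.BilinForm.baseChange R ω (1 ⊗ₜ[K] interleave B i) (A (1 ⊗ₜ[K] interleave B j)))

/-- The endomorphism `(M - s E)(N - s E) - t E` of the scalar extension `R ⊗ V`, for `M`, `N`
endomorphisms of `V` and `s`, `t` in `R`. -/
noncomputable def pencil (R : Type*) [CommRing R] [Algebra K R] (M N : Module.End K V)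
    (s t : R) : Module.End R (R ⊗[K] V) :=
  (LinearMap.baseChange R M - s • 1) * (LinearMap.baseChange R N - s • 1) - t • 1

/-- The symplectic characteristic polynomial
`P_M^ω(s, t) = Pf_ω(ω_{A - t E})`, with `A = (M - s E)(M^{*ω} - s E)`.
It is an element of `K[s][t]`, modelled by `K[X][X]`: the outer variable is `t = X`, and the
inner variable is `s = C X`. -/
noncomputable def symplCharpoly [FiniteDimensional K V] (ω : LinearMap.BilinForm K V)
    (hω : IsSymplectic ω) {n : ℕ} (hn : Module.finrank K V = 2 * n) (M : Module.End K V) :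
    K[X][X] :=
  pfaffianForm K[X][X] ω (symplBasis ω hω hn)
    (pencil K[X][X] M (symplAdjoint ω hω M) (C X) X)

end

end SymplecticLA

/-!
# Symplectic diagonalization of normal endomorphisms

Write `N` for the symplectic adjoint of `M`. The proof works with the commuting self-adjoint maps
`M + N` and `M N`, since `(M - s)(N - s) = M N - s (M + N) + s²`.

*From the polynomial to eigenvectors.* Substituting `t = (λᵢ - s)(μᵢ - s)` makes the Pfaffian of
`ω(v, (T - s S) w)` vanish, where `T = M N - λᵢ μᵢ` and `S = M + N - (λᵢ + μᵢ)`. An alternating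
matrix with vanishing Pfaffian is singular (`det_eq_zero_of_pfaffian_eq_zero`), in any
characteristic. This rests on Wick's formula (`pfaffian_eq_wickFunctional`): the Pfaffian of
`(B(vᵢ, vⱼ))` is the degree zero part of the image of `v₁ ∧ ⋯ ∧ v₂ₙ` under the deformation of the
exterior algebra by `-B`, hence an alternating multilinear function of the vectors. So `T - s S` has
a kernel vector that is polynomial in `s`, and its leading coefficient leads to a common kernel
vector of `S` and `T` (`exists_common_kernel_vector`).

*From eigenvectors to hyperbolic pairs.* Since `λᵢ ≠ μᵢ`, a common eigenvector of `M + N` and `M N`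
yields a common eigenvector of `M` and `N`, with eigenvalues `(λᵢ, μᵢ)` or `(μᵢ, λᵢ)`. Nondegeneracy
of `ω` provides a dual vector in the joint generalized eigenspace with the eigenvalues exchanged
(`exists_hyperbolic_pair`).

*From hyperbolic pairs to the basis.* Generalized eigenspaces of `M` and `N` with different
eigenvalues are `ω`-orthogonal, so the `2n` vectors satisfy the symplectic relations and form a
basis. The error terms such as `M e - λ e` are orthogonal to this basis, so they vanish
(`exists_eigenbasis_of_hyperbolic_pairs`).
-/

namespace SymplecticLA

/-! ### Wick's formula for the Pfaffian -/

section PfaffianWick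

variable {R M : Type*} [CommRing R] [AddCommGroup M] [Module R M]

/-- Contraction is an antiderivation, so it acts on a wedge product by the alternating sum over the
factors. -/
theorem contractLeft_ιMulti (d : Module.Dual R M) {k : ℕ} (v : Fin (k + 1) → M) :
    CliffordAlgebra.contractLeft (Q := (0 : QuadraticForm R M)) d
        (ExteriorAlgebra.ιMulti R (k + 1) v) =
      ∑ j : Fin (k + 1), ((-1) ^ (j : ℕ) * d (v j)) •
        ExteriorAlgebra.ιMulti R k (fun i => v (j.succAbove i)) := by
  induction k with
  | zero =>
    rw [ExteriorAlgebra.ιMulti_succ_apply, ExteriorAlgebra.ι, CliffordAlgebra.contractLeft_ι_mul]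
    simp
  | succ k ih =>
    rw [ExteriorAlgebra.ιMulti_succ_apply, ExteriorAlgebra.ι, CliffordAlgebra.contractLeft_ι_mul,
      ih, Fin.sum_univ_succ (n := k + 1), Finset.mul_sum, sub_eq_add_neg, ← Finset.sum_neg_distrib]
    congr 1
    · simp [Matrix.vecTail, Function.comp_def]
    · refine Finset.sum_congr rfl fun j _ => ?_
      rw [ExteriorAlgebra.ιMulti_succ_apply, ExteriorAlgebra.ι, mul_smul_comm, ← neg_smul]
      simp [Matrix.vecTail, Function.comp_def, pow_succ]

/-- The linear functional on the exterior algebra attached to an alternating form `B`: deform the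
wedge product by `-B` and take the component of degree zero. Its value on
`v₁ ∧ ⋯ ∧ v₂ₙ` is the Pfaffian of `(B (vᵢ, vⱼ))`; the sign of `-B` compensates the one with which
`CliffordAlgebra.changeForm` contracts. -/
noncomputable def wickFunctional (B : LinearMap.BilinForm R M) (hB : B.IsAlt) :
    ExteriorAlgebra R M →ₗ[R] R :=
  ExteriorAlgebra.algebraMapInv.toLinearMap ∘ₗ
    CliffordAlgebra.changeForm (Q := (0 : QuadraticForm R M)) (Q' := (0 : QuadraticForm R M))
      (B := -B) (by ext x; simp [hB x])

theorem wickFunctional_one (B : LinearMap.BilinForm R M) (hB : B.IsAlt) :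
    wickFunctional B hB 1 = 1 := by
  simp [wickFunctional]

theorem wickFunctional_ι_mul (B : LinearMap.BilinForm R M) (hB : B.IsAlt) (m : M)
    (x : ExteriorAlgebra R M) :
    wickFunctional B hB (ExteriorAlgebra.ι R m * x) =
      wickFunctional B hB (CliffordAlgebra.contractLeft (B m) x) := by
  have h0 : ExteriorAlgebra.algebraMapInv (CliffordAlgebra.ι (0 : QuadraticForm R M) m) =
      (0 : R) := by
    exact ExteriorAlgebra.lift_ι_apply R (0 : M →ₗ[R] R) (fun _ => by simp) m
  simp only [wickFunctional, LinearMap.comp_apply, AlgHom.toLinearMap_apply, ExteriorAlgebra.ι]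
  rw [CliffordAlgebra.changeForm_ι_mul, CliffordAlgebra.changeForm_contractLeft, map_sub, map_mul,
    h0]
  simp

/-- Wick's formula: the Laplace recursion of `pfaffian` is the recursion of `wickFunctional` under
contraction of the first vector with the remaining ones. -/
theorem pfaffian_eq_wickFunctional (B : LinearMap.BilinForm R M) (hB : B.IsAlt) (n : ℕ)
    (v : Fin (2 * n) → M) :
    pfaffian n (Matrix.of fun i j => B (v i) (v j)) =
      wickFunctional B hB (ExteriorAlgebra.ιMulti R (2 * n) v) := by
  induction n with
  | zero =>
    have : ExteriorAlgebra.ιMulti R (2 * 0) v = 1 := ExteriorAlgebra.ιMulti_zero_apply v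
    rw [this, wickFunctional_one, pfaffian]
  | succ n ih =>
    have h : ExteriorAlgebra.ιMulti R (2 * (n + 1)) v =
        ExteriorAlgebra.ι R (v 0) * ExteriorAlgebra.ιMulti R (2 * n + 1) (fun i => v i.succ) :=
      ExteriorAlgebra.ιMulti_succ_apply (n := 2 * n + 1) v
    rw [h, wickFunctional_ι_mul, contractLeft_ιMulti, map_sum, pfaffian]
    refine Finset.sum_congr rfl fun j _ => ?_
    rw [map_smul, smul_eq_mul, ← ih]
    rfl

theorem pfaffian_map {S : Type*} [CommRing S] (φ : R →+* S) (n : ℕ)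
    (A : Matrix (Fin (2 * n)) (Fin (2 * n)) R) :
    pfaffian n (A.map φ) = φ (pfaffian n A) := by
  induction n with
  | zero => simp [pfaffian]
  | succ n ih =>
    simp only [pfaffian, map_sum, map_mul, map_pow, map_neg, map_one, ← ih]
    rfl

end PfaffianWick

/-! ### Pfaffians over a field -/

section Field

variable {L : Type*} [Field L]

theorem interleave_two_mul {W : Type*} [AddCommGroup W] [Module L W] {n : ℕ}
    (B : Module.Basis (Fin n ⊕ Fin n) L W) (i : Fin n) :
    interleave B ⟨2 * i, by omega⟩ = B (Sum.inl i) := by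
  simp [interleave]

theorem interleave_two_mul_add_one {W : Type*} [AddCommGroup W] [Module L W] {n : ℕ}
    (B : Module.Basis (Fin n ⊕ Fin n) L W) (i : Fin n) :
    interleave B ⟨2 * i + 1, by omega⟩ = B (Sum.inr i) := by
  have h : (2 * (i : ℕ) + 1) / 2 = i := by omega
  simp [interleave, h, Nat.add_mod]

/-- The Pfaffian of the Gram matrix of a symplectic basis `(e₁, f₁, …, eₙ, fₙ)` is `1`. -/
theorem pfaffian_standard (n : ℕ) (A : Matrix (Fin (2 * n)) (Fin (2 * n)) L)
    (hA : ∀ i j, A i j = if (i : ℕ) % 2 = 0 ∧ (j : ℕ) = i + 1 then 1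
      else if (j : ℕ) % 2 = 0 ∧ (i : ℕ) = j + 1 then -1 else 0) :
    pfaffian n A = 1 := by
  induction n with
  | zero => simp [pfaffian]
  | succ n ih =>
    simp only [pfaffian]
    -- The first row of `A` has a single non-zero entry, in the second column.
    rw [Finset.sum_eq_single 0]
    · rw [ih]
      · simpa [Matrix.submatrix_apply, hA] using Nat.mod_eq_of_lt (by omega)
      · intro i j
        simp only [Matrix.submatrix_apply, hA, Fin.zero_succAbove, Fin.val_cast, Fin.val_succ]
        congr 1 <;> grind
    · intro j _ hj
      have : (j : ℕ) ≠ 0 := fun h => hj (Fin.ext h)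
      simp [Matrix.submatrix_apply, hA, this]
    · simp

theorem IsSymplecticBasis.pfaffian_interleave {W : Type*} [AddCommGroup W] [Module L W]
    {ω : LinearMap.BilinForm L W} (hω : ω.IsAlt) {n : ℕ}
    {B : Module.Basis (Fin n ⊕ Fin n) L W} (h : IsSymplecticBasis ω B) :
    pfaffian n (Matrix.of fun i j => ω (interleave B i) (interleave B j)) = 1 := by
  refine pfaffian_standard n _ fun i j => ?_
  have hee := fun i j => (h i j).1
  have hff := fun i j => (h i j).2.1
  have hef := fun i j => (h i j).2.2
  have hfe : ∀ i j, ω (B (Sum.inr i)) (B (Sum.inl j)) = if j = i then (-1 : L) else 0 := by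
    intro i j
    rw [← hω.neg_eq, hef]
    split_ifs <;> simp
  simp only [Matrix.of_apply, interleave]
  split_ifs <;> simp_all [Fin.ext_iff] <;> omega

/-- An alternating matrix over a field with vanishing Pfaffian is singular: otherwise it is the
Gram matrix of a symplectic form, and the alternating map which computes Pfaffians of Gram matrices
takes the value `1` at a symplectic basis, so it cannot vanish at the standard one. -/
theorem det_eq_zero_of_pfaffian_eq_zero {n : ℕ} (A : Matrix (Fin (2 * n)) (Fin (2 * n)) L)
    (hA : (Matrix.toBilin' A).IsAlt) (h : pfaffian n A = 0) : A.det = 0 := by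
  by_contra hdet
  have hS : IsSymplectic (Matrix.toBilin' A) :=
    ⟨hA, LinearMap.BilinForm.nondegenerate_toBilin'_of_det_ne_zero' A hdet⟩
  obtain ⟨B, hB⟩ := hS.exists_basis (n := n) (by simp)
  let g : (Fin (2 * n) → L) [⋀^Fin (2 * n)]→ₗ[L] L :=
    (wickFunctional _ hA).compAlternatingMap (ExteriorAlgebra.ιMulti L (2 * n))
  have hg (v) : g v = pfaffian n (Matrix.of fun i j => Matrix.toBilin' A (v i) (v j)) :=
    (pfaffian_eq_wickFunctional _ hA n v).symm
  have h0 : g (Pi.basisFun L (Fin (2 * n))) = 0 := by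
    rw [hg, ← h]
    congr 1
    ext i j
    simp
  rw [AlternatingMap.map_basis_eq_zero_iff] at h0
  have h1 := hg (interleave B)
  rw [hB.pfaffian_interleave hA, h0] at h1
  simp at h1

end Field

/-! ### Generalized eigenvectors of a map and its adjoint -/

section Adjoint

variable {K V : Type*} [Field K] [AddCommGroup V] [Module K V]
  {ω : LinearMap.BilinForm K V} {M N : Module.End K V}

theorem adjoint_symm (hω : ω.IsAlt) (hMN : ∀ v w, ω (M v) w = ω v (N w)) (v w : V) :
    ω (N v) w = ω v (M w) := by
  rw [← hω.neg_eq, ← hMN, hω.neg_eq]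

theorem apply_aeval_left (hMN : ∀ v w, ω (M v) w = ω v (N w)) (p : K[X]) (x y : V) :
    ω (aeval M p x) y = ω x (aeval N p y) := by
  have hpow (k : ℕ) : ∀ x y, ω ((M ^ k) x) y = ω x ((N ^ k) y) := by
    induction k with
    | zero => simp
    | succ k ih =>
      intro x y
      rw [pow_succ, pow_succ', Module.End.mul_apply, Module.End.mul_apply, ih, hMN]
  induction p using Polynomial.induction_on' with
  | add p q hp hq => simp [hp, hq]
  | monomial k a => simp [aeval_monomial, hpow, Algebra.algebraMap_eq_smul_one]

theorem apply_eq_zero_of_isCoprime (hMN : ∀ v w, ω (M v) w = ω v (N w)) {p q : K[X]}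
    (hpq : IsCoprime p q) {x y : V} (hx : aeval M p x = 0) (hy : aeval N q y = 0) :
    ω x y = 0 := by
  obtain ⟨u, v, h⟩ := hpq
  have h1 : aeval M (v * q) x = x := by
    have := congrArg (fun r => aeval M r x) h
    simpa [hx] using this
  rw [← h1, apply_aeval_left hMN, map_mul, Module.End.mul_apply, hy, map_zero, map_zero]

theorem mem_maxGenEigenspace_iff_aeval {a : K} {x : V} :
    x ∈ M.maxGenEigenspace a ↔ ∃ k : ℕ, aeval M ((X - C a) ^ k) x = 0 := by
  simp [Module.End.mem_maxGenEigenspace, Algebra.algebraMap_eq_smul_one]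

theorem apply_eq_zero_of_mem_maxGenEigenspace (hMN : ∀ v w, ω (M v) w = ω v (N w)) {a b : K}
    (hab : a ≠ b) {x y : V} (hx : x ∈ M.maxGenEigenspace a) (hy : y ∈ N.maxGenEigenspace b) :
    ω x y = 0 := by
  obtain ⟨k, hk⟩ := mem_maxGenEigenspace_iff_aeval.1 hx
  obtain ⟨l, hl⟩ := mem_maxGenEigenspace_iff_aeval.1 hy
  exact apply_eq_zero_of_isCoprime hMN
    (IsCoprime.pow (Polynomial.isCoprime_X_sub_C_of_isUnit_sub (sub_ne_zero.2 hab).isUnit)) hk hl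

/-- The cofactor of the largest power of `X - a` in the minimal polynomial of `A` maps `V` into the
generalized eigenspace of `a`. -/
theorem exists_aeval_mem_maxGenEigenspace [FiniteDimensional K V] (A : Module.End K V) (a : K) :
    ∃ q : K[X], q.eval a ≠ 0 ∧ ∀ g, aeval A q g ∈ A.maxGenEigenspace a := by
  obtain ⟨q, hq, hdvd⟩ := (minpoly K A).exists_eq_pow_rootMultiplicity_mul_and_not_dvd
    (minpoly.ne_zero (Algebra.IsIntegral.isIntegral A)) a
  refine ⟨q, fun h => hdvd (dvd_iff_isRoot.2 h), fun g => ?_⟩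
  refine mem_maxGenEigenspace_iff_aeval.2 ⟨(minpoly K A).rootMultiplicity a, ?_⟩
  rw [← Module.End.mul_apply, ← map_mul, ← hq, minpoly.aeval, LinearMap.zero_apply]

theorem aeval_apply_of_apply_eq_smul {a : K} {x : V} (hx : M x = a • x) (p : K[X]) :
    aeval M p x = p.eval a • x := by
  rcases eq_or_ne x 0 with rfl | h0
  · simp
  · exact Module.End.aeval_apply_of_hasEigenvector ⟨Module.End.mem_eigenspace_iff.2 hx, h0⟩

/-- A common eigenvector `x` of `M` and its adjoint `N` with eigenvalues `a`, `b` has a dual vector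
that is a generalized eigenvector with the eigenvalues exchanged. Take any `g` with `ω(x, g) ≠ 0` and
project it by polynomials in `M` and `N`: moved to the other side of `ω`, these act on `x` by nonzero
scalars. -/
theorem exists_dual_generalized_eigenvector [FiniteDimensional K V] (hω : IsSymplectic ω)
    (hMN : ∀ v w, ω (M v) w = ω v (N w)) (hcomm : Commute M N) {a b : K} {x : V} (hx0 : x ≠ 0)
    (hMx : M x = a • x) (hNx : N x = b • x) :
    ∃ y, y ∈ M.maxGenEigenspace b ∧ y ∈ N.maxGenEigenspace a ∧ ω x y = 1 := by
  obtain ⟨g, hg⟩ : ∃ g, ω x g ≠ 0 := by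
    by_contra! hc
    exact hx0 (hω.nondegenerate.1 x hc)
  obtain ⟨q, hq, hqM⟩ := exists_aeval_mem_maxGenEigenspace M b
  obtain ⟨r, hr, hrN⟩ := exists_aeval_mem_maxGenEigenspace N a
  have hc : aeval M q (aeval N r g) = aeval N r (aeval M q g) := by
    have h1 : Commute (aeval M q) (aeval N r) := by
      refine Algebra.commute_of_mem_adjoin_singleton_of_commute
        (aeval_mem_adjoin_singleton K N) ?_
      exact (Algebra.commute_of_mem_adjoin_singleton_of_commute
        (aeval_mem_adjoin_singleton K M) hcomm.symm).symm
    exact LinearMap.congr_fun h1.eq g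
  have hne : ω x (aeval M q (aeval N r g)) ≠ 0 := by
    rw [← apply_aeval_left (adjoint_symm hω.alt hMN), aeval_apply_of_apply_eq_smul hNx,
      map_smul, LinearMap.smul_apply, ← apply_aeval_left hMN, aeval_apply_of_apply_eq_smul hMx,
      map_smul, LinearMap.smul_apply]
    exact smul_ne_zero hq (smul_ne_zero hr hg)
  refine ⟨(ω x (aeval M q (aeval N r g)))⁻¹ • aeval M q (aeval N r g),
    Submodule.smul_mem _ _ (hqM _), Submodule.smul_mem _ _ (hc ▸ hrN _), ?_⟩
  rw [map_smul, smul_eq_mul, inv_mul_cancel₀ hne]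

/-- A common eigenvector of `M + N` and `M N` with eigenvalues `a + b` and `a b`, `a ≠ b`, produces
a hyperbolic pair of generalized eigenvectors. One member of the pair is a genuine eigenvector of
both maps, but which one depends on the given vector; the last two conditions record the consequence
of this that is symmetric in `e` and `f`. -/
theorem exists_hyperbolic_pair [FiniteDimensional K V] (hω : IsSymplectic ω)
    (hMN : ∀ v w, ω (M v) w = ω v (N w)) (hcomm : Commute M N) {a b : K} {v : V}
    (hv0 : v ≠ 0) (hadd : (M + N) v = (a + b) • v) (hmul : (M * N) v = (a * b) • v) :
    ∃ e f, e ∈ M.maxGenEigenspace a ∧ e ∈ N.maxGenEigenspace b ∧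
      f ∈ M.maxGenEigenspace b ∧ f ∈ N.maxGenEigenspace a ∧
      ω e f = 1 ∧ ω (M e) f = a ∧ ω (N e) f = b := by
  have hmem {A : Module.End K V} {c : K} {x : V} (h : A x = c • x) :
      x ∈ A.maxGenEigenspace c :=
    (Module.End.mem_maxGenEigenspace ..).2 ⟨1, by simp [h]⟩
  have hNv : N v = (a + b) • v - M v := by rw [← hadd]; simp
  have hMMv : M (M v) = (a + b) • M v - (a * b) • v := by
    rw [← hmul, Module.End.mul_apply, hNv]; simp
  by_cases hw : M v = b • v
  · have hNw : N v = a • v := by rw [hNv, hw]; module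
    obtain ⟨y, hyM, hyN, hy⟩ := exists_dual_generalized_eigenvector hω hMN hcomm hv0 hw hNw
    have hyv : ω (-y) v = 1 := by rw [map_neg, LinearMap.neg_apply, hω.alt.neg_eq, hy]
    refine ⟨-y, v, neg_mem hyM, neg_mem hyN, hmem hw, hmem hNw, hyv, ?_, ?_⟩
    · rw [hMN, hNw, map_smul, hyv, smul_eq_mul, mul_one]
    · rw [adjoint_symm hω.alt hMN, hw, map_smul, hyv, smul_eq_mul, mul_one]
  · have hw0 : M v - b • v ≠ 0 := sub_ne_zero.2 hw
    have hMw : M (M v - b • v) = a • (M v - b • v) := by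
      rw [map_sub, map_smul, hMMv]; module
    have hNw : N (M v - b • v) = b • (M v - b • v) := by
      have : N (M v) = (a * b) • v := by
        rw [← hmul, hcomm.eq, Module.End.mul_apply]
      rw [map_sub, map_smul, this, hNv]; module
    obtain ⟨y, hyM, hyN, hy⟩ := exists_dual_generalized_eigenvector hω hMN hcomm hw0 hMw hNw
    refine ⟨_, y, hmem hMw, hmem hNw, hyM, hyN, hy, ?_, ?_⟩
    · rw [hMw, map_smul, LinearMap.smul_apply, hy, smul_eq_mul, mul_one]
    · rw [hNw, map_smul, LinearMap.smul_apply, hy, smul_eq_mul, mul_one]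

/-- If a nonzero polynomial vector `∑ sᵏ wₖ` is annihilated by `T - s S`, with `S` and `T` commuting
and independent of `s`, then `S` and `T` have a common kernel vector: the leading coefficient is
killed by `S` and by a power of `T`. -/
theorem exists_common_kernel_vector {S T : Module.End K V} (hST : Commute S T) (w : ℕ → V)
    (h0 : T (w 0) = 0) (hsucc : ∀ k, T (w (k + 1)) = S (w k)) (hne : ∃ k, w k ≠ 0)
    (hfin : ∃ D, ∀ k, D ≤ k → w k = 0) : ∃ v ≠ 0, S v = 0 ∧ T v = 0 := by
  have hcomm (x) : S (T x) = T (S x) := LinearMap.congr_fun hST.eq x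
  have hcommpow (k : ℕ) (x) : S ((T ^ k) x) = (T ^ k) (S x) :=
    LinearMap.congr_fun (hST.pow_right k).eq x
  have hnil (k : ℕ) : (T ^ (k + 1)) (w k) = 0 := by
    induction k with
    | zero => simpa using h0
    | succ k ih => rw [pow_succ, Module.End.mul_apply, hsucc, ← hcommpow, ih, map_zero]
  obtain ⟨d, hd, hSd⟩ : ∃ d, w d ≠ 0 ∧ S (w d) = 0 := by
    classical
    have hpos : Nat.find hfin ≠ 0 := by
      intro h
      obtain ⟨k, hk⟩ := hne
      exact hk (Nat.find_spec hfin k (by omega))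
    obtain ⟨d, hd⟩ := Nat.exists_eq_succ_of_ne_zero hpos
    refine ⟨d, fun hwd => ?_, ?_⟩
    · refine Nat.find_min hfin (m := d) (by omega) fun k hk => ?_
      rcases hk.eq_or_lt with rfl | hk
      · exact hwd
      · exact Nat.find_spec hfin k (by omega)
    · rw [← hsucc, Nat.find_spec hfin (d + 1) (by omega), map_zero]
  classical
  have hex : ∃ k, (T ^ k) (w d) = 0 := ⟨_, hnil d⟩
  have hpos : Nat.find hex ≠ 0 := by
    intro h
    have := Nat.find_spec hex
    rw [h] at this
    exact hd (by simpa using this)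
  obtain ⟨k, hk⟩ := Nat.exists_eq_succ_of_ne_zero hpos
  refine ⟨(T ^ k) (w d), Nat.find_min hex (by omega), ?_, ?_⟩
  · rw [hcommpow, hSd, map_zero]
  · have := Nat.find_spec hex
    rwa [hk, Nat.succ_eq_add_one, pow_succ', Module.End.mul_apply] at this

end Adjoint

/-! ### Zeros of the symplectic characteristic polynomial -/

section Charpoly

variable {K V : Type*} [Field K] [AddCommGroup V] [Module K V]
  {ω : LinearMap.BilinForm K V}

theorem linearIndependent_interleave {n : ℕ} (B : Module.Basis (Fin n ⊕ Fin n) K V) :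
    LinearIndependent K (interleave B) := by
  let g : Fin (2 * n) → Fin n ⊕ Fin n := fun k =>
    if (k : ℕ) % 2 = 0 then Sum.inl ⟨k / 2, by omega⟩ else Sum.inr ⟨k / 2, by omega⟩
  have hg : Function.Injective g := by
    intro i j h
    simp only [g] at h
    split_ifs at h <;> simp only [Sum.inl.injEq, Sum.inr.injEq, Fin.mk.injEq] at h
    all_goals exact Fin.ext (by omega)
  have h : interleave B = B ∘ g := by
    ext k
    simp only [interleave, g, Function.comp_apply]
    split_ifs <;> rfl
  rw [h]
  exact B.linearIndependent.comp g hg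

theorem eq_zero_of_apply_interleave_eq_zero (hω : IsSymplectic ω) {n : ℕ}
    (B : Module.Basis (Fin n ⊕ Fin n) K V) {x : V} (h : ∀ i, ω (interleave B i) x = 0) :
    x = 0 := by
  have hx : LinearMap.flip ω x = 0 := by
    refine B.ext ?_
    rintro (i | i)
    · simpa [interleave_two_mul] using h ⟨2 * i, by omega⟩
    · simpa [interleave_two_mul_add_one] using h ⟨2 * i + 1, by omega⟩
  exact hω.nondegenerate.2 x fun y => LinearMap.congr_fun hx y

theorem toBilin'_isAlt {R ι : Type*} [CommRing R] [Fintype ι] [DecidableEq ι] {A : Matrix ι ι R}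
    (hdiag : ∀ i, A i i = 0) (hneg : ∀ i j, A i j = -A j i) : (Matrix.toBilin' A).IsAlt := by
  intro x
  rw [Matrix.toBilin'_apply, ← Finset.sum_product']
  refine Finset.sum_involution (fun p _ => (p.2, p.1)) ?_ ?_ ?_ ?_
  · rintro ⟨i, j⟩ -
    rw [hneg i j]
    ring
  · rintro ⟨i, j⟩ - h1 h2
    obtain rfl : j = i := congrArg Prod.fst h2
    simp [hdiag] at h1
  · simp
  · simp

theorem pfaffianForm_pencil (R : Type*) [CommRing R] [Algebra K R] {n : ℕ}
    (B : Module.Basis (Fin n ⊕ Fin n) K V) (M N : Module.End K V) (s t : R) :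
    pfaffianForm R ω B (pencil R M N s t) =
      pfaffian n (Matrix.of fun i j =>
        algebraMap K R (ω (interleave B i) (M (N (interleave B j)))) -
          s * algebraMap K R (ω (interleave B i) ((M + N) (interleave B j))) +
          (s ^ 2 - t) * algebraMap K R (ω (interleave B i) (interleave B j))) := by
  rw [pfaffianForm]
  congr 1
  ext i j
  simp [pencil, Algebra.smul_def, TensorProduct.smul_tmul']
  ring

/-- If the symplectic characteristic polynomial vanishes at `t = (a - s) (b - s)`, then `M + N` and
`M N` have a common eigenvector with eigenvalues `a + b` and `a b`, where `N` is the adjoint of `M`.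
Indeed `(M - s) (N - s) - (a - s) (b - s) = (M N - a b) - s (M + N - (a + b))` is then singular over
the polynomials in `s`. -/
theorem exists_common_eigenvector_of_pfaffianForm_eq_zero (hω : IsSymplectic ω) {n : ℕ}
    (B : Module.Basis (Fin n ⊕ Fin n) K V) {M N : Module.End K V}
    (hMN : ∀ v w, ω (M v) w = ω v (N w)) (hcomm : Commute M N) (a b : K)
    (h : (pfaffianForm K[X][X] ω B (pencil K[X][X] M N (C X) X)).eval
      ((C a - X) * (C b - X)) = 0) :
    ∃ v ≠ 0, (M + N) v = (a + b) • v ∧ (M * N) v = (a * b) • v := by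
  let S : Module.End K V := M + N - (a + b) • 1
  let T : Module.End K V := M * N - (a * b) • 1
  have hST : Commute S T := by
    have h1 : Commute (M + N) (M * N) :=
      ((Commute.refl M).mul_right hcomm).add_left (hcomm.symm.mul_right (Commute.refl N))
    exact (h1.sub_right ((Commute.one_right _).smul_right _)).sub_left
      (((Commute.one_left _).smul_left _))
  have hSalt (x : V) : ω x (S x) = 0 := by
    simp [S, ← hMN, hω.alt x, ← hω.alt.neg_eq (M x) x]
  have hTalt (x : V) : ω x (T x) = 0 := by
    simp [T, ← adjoint_symm hω.alt hMN, hω.alt x, hω.alt (N x)]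
  have hneg (A : Module.End K V) (hA : ∀ x, ω x (A x) = 0) (x y : V) :
      ω x (A y) = -ω y (A x) :=
    (LinearMap.IsAlt.neg (B := ω.compl₂ A) hA y x).symm
  let v := interleave B
  let G : Matrix (Fin (2 * n)) (Fin (2 * n)) K[X] := Matrix.of fun i j =>
    C (ω (v i) (T (v j))) - X * C (ω (v i) (S (v j)))
  have hG : pfaffian n G = 0 := by
    rw [← h, pfaffianForm_pencil, ← coe_evalRingHom, ← pfaffian_map]
    congr 1
    ext1 i j
    -- The quadratic terms in `s` cancel, because `s² - (a - s) (b - s) = (a + b) s - a b`.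
    simp [G, S, T, v, Polynomial.algebraMap_apply]
    ring
  have hdet : G.det = 0 := by
    let L := FractionRing K[X]
    have hinj : Function.Injective (algebraMap K[X] L) := IsFractionRing.injective K[X] L
    refine hinj ?_
    rw [map_zero, RingHom.map_det]
    refine det_eq_zero_of_pfaffian_eq_zero _ (toBilin'_isAlt ?_ ?_) ?_
    · intro i
      simp [G, hSalt, hTalt]
    · intro i j
      simp only [RingHom.mapMatrix_apply, Matrix.map_apply, ← map_neg, G, Matrix.of_apply]
      rw [hneg S hSalt, hneg T hTalt]
      congr 1
      simp
      ring
    · rw [RingHom.mapMatrix_apply, pfaffian_map, hG, map_zero]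
  obtain ⟨c, hc0, hc⟩ := Matrix.exists_mulVec_eq_zero_iff.2 hdet
  -- The coefficients in `s` of the kernel vector, as elements of `V`.
  let w : ℕ → V := fun k => ∑ j, (c j).coeff k • v j
  have hGc (i) : ∑ j, (C (ω (v i) (T (v j))) - X * C (ω (v i) (S (v j)))) * c j = 0 :=
    congrFun hc i
  have h0 : T (w 0) = 0 := by
    refine eq_zero_of_apply_interleave_eq_zero hω B fun i => ?_
    have := congrArg (fun p => p.coeff 0) (hGc i)
    simp only [finsetSum_coeff, sub_mul, mul_assoc, coeff_sub, coeff_C_mul, coeff_X_mul_zero,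
      sub_zero, coeff_zero] at this
    simp only [w, map_sum, map_smul, smul_eq_mul]
    rw [← this]
    simp only [v, mul_comm]
  have hsucc (k) : T (w (k + 1)) = S (w k) := by
    rw [← sub_eq_zero]
    refine eq_zero_of_apply_interleave_eq_zero hω B fun i => ?_
    have := congrArg (fun p => p.coeff (k + 1)) (hGc i)
    simp only [finsetSum_coeff, sub_mul, mul_assoc, coeff_sub, coeff_C_mul, coeff_X_mul,
      Finset.sum_sub_distrib, coeff_zero] at this
    simp only [w, map_sub, map_sum, map_smul, smul_eq_mul]
    rw [← this]
    simp only [v, mul_comm]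
  have hne : ∃ k, w k ≠ 0 := by
    by_contra! hw
    refine hc0 (funext fun j => Polynomial.ext fun k => ?_)
    exact Fintype.linearIndependent_iff.1 (linearIndependent_interleave B) _ (hw k) j
  have hfin : ∃ D, ∀ k, D ≤ k → w k = 0 := by
    refine ⟨Finset.univ.sup (fun j => (c j).natDegree) + 1, fun k hk => ?_⟩
    refine Finset.sum_eq_zero fun j _ => ?_
    have := Finset.le_sup (f := fun j => (c j).natDegree) (Finset.mem_univ j)
    rw [coeff_eq_zero_of_natDegree_lt (by omega), zero_smul]
  obtain ⟨x, hx0, hSx, hTx⟩ := exists_common_kernel_vector hST w h0 hsucc hne hfin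
  exact ⟨x, hx0, sub_eq_zero.1 hSx, sub_eq_zero.1 hTx⟩

end Charpoly

/-! ### Symplectic bases of eigenvectors -/

section Eigenbasis

variable {K V : Type*} [Field K] [AddCommGroup V] [Module K V]
  {ω : LinearMap.BilinForm K V}

/-- Hyperbolic pairs of joint generalized eigenvectors with pairwise distinct eigenvalue pairs form
a symplectic basis, and the members are genuine eigenvectors because the error terms
`M e - a e`, … are orthogonal to the whole basis. -/
theorem exists_eigenbasis_of_hyperbolic_pairs [FiniteDimensional K V] (hω : IsSymplectic ω)
    {n : ℕ} (hn : Module.finrank K V = 2 * n) {M N : Module.End K V}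
    (hMN : ∀ v w, ω (M v) w = ω v (N w)) (hcomm : Commute M N) {l m : Fin n → K} {e f : Fin n → V}
    (hsame : ∀ i j, i ≠ j → ¬(l i = l j ∧ m i = m j)) (hswap : ∀ i j, ¬(l i = m j ∧ m i = l j))
    (heM : ∀ i, e i ∈ M.maxGenEigenspace (l i)) (heN : ∀ i, e i ∈ N.maxGenEigenspace (m i))
    (hfM : ∀ i, f i ∈ M.maxGenEigenspace (m i)) (hfN : ∀ i, f i ∈ N.maxGenEigenspace (l i))
    (hef : ∀ i, ω (e i) (f i) = 1) (hMef : ∀ i, ω (M (e i)) (f i) = l i)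
    (hNef : ∀ i, ω (N (e i)) (f i) = m i) :
    ∃ B : Module.Basis (Fin n ⊕ Fin n) K V, IsSymplecticBasis ω B ∧
      ∀ i, M (B (Sum.inl i)) = l i • B (Sum.inl i) ∧ N (B (Sum.inl i)) = m i • B (Sum.inl i) ∧
        M (B (Sum.inr i)) = m i • B (Sum.inr i) ∧ N (B (Sum.inr i)) = l i • B (Sum.inr i) := by
  have hNM := adjoint_symm hω.alt hMN
  let U (a b : K) : Submodule K V := M.maxGenEigenspace a ⊓ N.maxGenEigenspace b
  have hU {a b a' b' : K} (h : ¬(a = b' ∧ b = a')) {x y : V} (hx : x ∈ U a b)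
      (hy : y ∈ U a' b') : ω x y = 0 := by
    by_cases h1 : a = b'
    · exact apply_eq_zero_of_mem_maxGenEigenspace hNM (fun h2 => h ⟨h1, h2⟩) hx.2 hy.1
    · exact apply_eq_zero_of_mem_maxGenEigenspace hMN h1 hx.1 hy.2
  have hUM {a b : K} {x : V} (c : K) (hx : x ∈ U a b) : M x - c • x ∈ U a b :=
    ⟨sub_mem (Module.End.mapsTo_maxGenEigenspace_of_comm (Commute.refl M) a hx.1)
        (Submodule.smul_mem _ _ hx.1),
      sub_mem (Module.End.mapsTo_maxGenEigenspace_of_comm hcomm.symm b hx.2)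
        (Submodule.smul_mem _ _ hx.2)⟩
  have hUN {a b : K} {x : V} (c : K) (hx : x ∈ U a b) : N x - c • x ∈ U a b :=
    ⟨sub_mem (Module.End.mapsTo_maxGenEigenspace_of_comm hcomm a hx.1)
        (Submodule.smul_mem _ _ hx.1),
      sub_mem (Module.End.mapsTo_maxGenEigenspace_of_comm (Commute.refl N) b hx.2)
        (Submodule.smul_mem _ _ hx.2)⟩
  have he (i) : e i ∈ U (l i) (m i) := ⟨heM i, heN i⟩
  have hf (i) : f i ∈ U (m i) (l i) := ⟨hfM i, hfN i⟩
  have hrel : SymplecticRelations ω e f := by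
    intro i j
    refine ⟨hU (hswap i j) (he i) (he j), hU (fun h => hswap i j h.symm) (hf i) (hf j), ?_⟩
    split_ifs with hij
    · rw [← hij, hef]
    · exact hU (hsame i j hij) (he i) (hf j)
  let B : Module.Basis (Fin n ⊕ Fin n) K V :=
    basisOfLinearIndependentOfCardEqFinrank' _ (hrel.linearIndependent hω.alt)
      (by simp [hn, two_mul])
  have hBe (i) : B (Sum.inl i) = e i := by simp [B]
  have hBf (i) : B (Sum.inr i) = f i := by simp [B]
  have hzero {x : V} (h1 : ∀ j, ω x (e j) = 0) (h2 : ∀ j, ω x (f j) = 0) : x = 0 := by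
    have hx : ω x = 0 := by
      refine B.ext ?_
      rintro (j | j)
      · simp [hBe, h1]
      · simp [hBf, h2]
    exact hω.nondegenerate.1 x fun y => LinearMap.congr_fun hx y
  have hzero_e {i} {x : V} (hx : x ∈ U (l i) (m i)) (h : ω x (f i) = 0) : x = 0 := by
    refine hzero (fun j => hU (hswap i j) hx (he j)) fun j => ?_
    by_cases hij : i = j
    · rwa [← hij]
    · exact hU (hsame i j hij) hx (hf j)
  have hzero_f {i} {x : V} (hx : x ∈ U (m i) (l i)) (h : ω (e i) x = 0) : x = 0 := by
    refine hzero (fun j => ?_) fun j => hU (fun h => hswap i j h.symm) hx (hf j)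
    by_cases hij : i = j
    · rw [← hij, ← hω.alt.neg_eq, h, neg_zero]
    · exact hU (fun h => hsame i j hij h.symm) hx (he j)
  refine ⟨B, ?_, fun i => ?_⟩
  · simpa only [IsSymplecticBasis, hBe, hBf] using hrel
  · rw [hBe, hBf]
    refine ⟨sub_eq_zero.1 (hzero_e (hUM _ (he i)) ?_), sub_eq_zero.1 (hzero_e (hUN _ (he i)) ?_),
      sub_eq_zero.1 (hzero_f (hUM _ (hf i)) ?_), sub_eq_zero.1 (hzero_f (hUN _ (hf i)) ?_)⟩
    · simp [hMef, hef]
    · simp [hNef, hef]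
    · simp [← hNM, hNef, hef]
    · simp [← hMN, hMef, hef]

end Eigenbasis

end SymplecticLA

theorem mainTheorem5 {K V : Type*} [Field K] [AddCommGroup V] [Module K V]
    [FiniteDimensional K V] (n : ℕ) (hn : Module.finrank K V = 2 * n)
    (ω : LinearMap.BilinForm K V) (hω : SymplecticLA.IsSymplectic ω)
    (M : Module.End K V)
    (hM : M * SymplecticLA.symplAdjoint ω hω M = SymplecticLA.symplAdjoint ω hω M * M)
    (l m : Fin n → K)
    (hP : SymplecticLA.symplCharpoly ω hω hn M =
      ∏ i, (C ((C (l i) - X) * (C (m i) - X)) - X : K[X][X]))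
    (hdist : ∀ i j, i ≠ j →
      ((C (l i) - X) * (C (m i) - X) : K[X]) ≠ (C (l j) - X) * (C (m j) - X))
    (hlm : ∀ i, l i ≠ m i) :
    (∃ B : Module.Basis (Fin n ⊕ Fin n) K V, SymplecticLA.IsSymplecticBasis ω B ∧
      ∀ i, M (B (Sum.inl i)) = l i • B (Sum.inl i) ∧
        SymplecticLA.symplAdjoint ω hω M (B (Sum.inl i)) = m i • B (Sum.inl i) ∧
        M (B (Sum.inr i)) = m i • B (Sum.inr i) ∧
        SymplecticLA.symplAdjoint ω hω M (B (Sum.inr i)) = l i • B (Sum.inr i)) ∧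
    SymplecticLA.IsSymplecticallyDiagonalizable ω M := by
  have hMN := SymplecticLA.symplAdjoint_spec ω hω M
  have hvec (i : Fin n) :=
    SymplecticLA.exists_common_eigenvector_of_pfaffianForm_eq_zero hω
      (SymplecticLA.symplBasis ω hω hn) hMN hM (l i) (m i) (by
        rw [← SymplecticLA.symplCharpoly, hP, eval_prod]
        exact Finset.prod_eq_zero (Finset.mem_univ i) (by simp))
  choose v hv0 hadd hmul using hvec
  have hpair (i : Fin n) :=
    SymplecticLA.exists_hyperbolic_pair hω hMN hM (hv0 i) (hadd i) (hmul i)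
  choose e f heM heN hfM hfN hef hMef hNef using hpair
  have hsame (i j) (hij : i ≠ j) : ¬(l i = l j ∧ m i = m j) :=
    fun h => hdist i j hij (by rw [h.1, h.2])
  have hswap (i j) : ¬(l i = m j ∧ m i = l j) := by
    rintro ⟨h1, h2⟩
    by_cases hij : i = j
    · subst hij
      exact hlm i h1
    · exact hdist i j hij (by rw [h1, h2, mul_comm])
  obtain ⟨B, hB, hev⟩ := SymplecticLA.exists_eigenbasis_of_hyperbolic_pairs hω hn hMN hM hsame hswap
    heM heN hfM hfN hef hMef hNef
  refine ⟨⟨B, hB, hev⟩, n, B, hB, ?_⟩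
  rintro (i | i)
  · exact ⟨l i, Module.End.mem_eigenspace_iff.2 (hev i).1, B.ne_zero _⟩
  · exact ⟨m i, Module.End.mem_eigenspace_iff.2 (hev i).2.2.1, B.ne_zero _⟩
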